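/- Let $\mathbb F_q$ be any finite field and let $K,U,K_c$ be integers with $2\le K_c<U\le K-1$. There are a server and users $1,\dots,K$. User $i$ has an input $W_i\in\mathbb F_q^L$ and a key $P_i$. The inputs are independent and uniform, and the keys have a joint law chosen by the scheme. The server has a random demand matrix $\mathbf F=(a_{n,i})\in\mathbb F_q^{K_c\times K}$, uniform on the matrices of rank $K_c$ without zero column, and private randomness $S$. The inputs $(W_i)_i$, the keys $(P_i)_i$, $\mathbf F$ and $S$ are independent. In the first round the server sends a query $Q_{1,i}$ (a function of $\mathbf F,S$) to each user $i$, who answers with $X_i\in\mathbb F_q^{\ell_i}$, a function of $W_i,P_i,Q_{1,i}$. Let $\mathcal U_1\subseteq\{1,\dots,K\}$, $|\mathcal U_1|\ge U$, be the set of users surviving the first round. In the second round each user $i\in\mathcal U_1$ is told $\mathcal U_1$ and receives a query $Q_{2,i}^{\mathcal U_1}$ (a function of $\mathbf F,S,\mathcal U_1$), and answers with $Y_i^{\mathcal U_1}\in\mathbb F_q^{m_i(\mathcal U_1)}$, a function of $W_i,P_i,Q_{1,i},Q_{2,i}^{\mathcal U_1},\mathcal U_1$. Put $T_{\mathcal U_1}=\big(\sum_{i\in\mathcal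 U_1}a_{n,i}W_i\big)_{n=1}^{K_c}$ and define the rates $$R_1=\max_i \frac{\ell_i}{L},\qquad R_2=\max_{|\mathcal U_1|\ge U}\ \max_{i\in\mathcal U_1}\frac{m_i(\mathcal U_1)}{L}.$$ Then for all sufficiently large $L$ divisible by $U-1$ there is such a scheme with $$R_1=1,\qquad R_2=\frac{K_c}{U-1},$$ which satisfies, for all $\mathcal U_2\subseteq\mathcal U_1\subseteq\{1,\dots,K\}$ with $|\mathcal U_2|\ge U$: 1. (decodability) $H\big(T_{\mathcal U_1}\,\big|\,(X_i)_{i\in\mathcal U_1},(Q_{1,i})_{i\le K},(Q^{\mathcal U_1}_{2,i})_{i\in\mathcal U_1},(Y_i^{\mathcal U_1})_{i\in\mathcal U_2}\big)=0$; 2. (security) $I\big((W_i)_{i\le K};(X_i)_{i\le K},(Y_i^{\mathcal U_1})_{i\in\mathcal U_1},(Q_{1,i})_{i\le K},(Q^{\mathcal U_1}_{2,i})_{i\in\mathcal U_1}\,\big|\,\mathbf F,T_{\mathcal U_1}\big)=0$; 3. (demand privacy) $I\big(\mathbf F;W_i,P_i,Q_{1,i},Q_{2,i}^{\mathcal U_1},X_i,Y_i^{\mathcal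 U_1}\big)=0$ for every user $i\le K$, where $Q_{2,i}^{\mathcal U_1}$ and $Y_i^{\mathcal U_1}$ are absent if $i\notin\mathcal U_1$. -/

import Mathlib

universe u

noncomputable section

namespace SecAgg

/-! ### Shannon information quantities of finitely valued random variables -/

section Information

variable {Ω α β γ : Type*}

/-- Shannon entropy, in base `q`, of the random variable `X` when the outcome has law `p`. -/
def entropy [Fintype α] (q : ℕ) (p : PMF Ω) (X : Ω → α) : ℝ :=
  -∑ a, (p.map X a).toReal * Real.logb q (p.map X a).toReal

/-- Conditional entropy `H(X | Y) = H(X, Y) - H(Y)`. -/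
def condEntropy [Fintype α] [Fintype β] (q : ℕ) (p : PMF Ω) (X : Ω → α) (Y : Ω → β) : ℝ :=
  entropy q p (fun ω => (X ω, Y ω)) - entropy q p Y

/-- Mutual information `I(X ; Y) = H(X) - H(X | Y)`. -/
def mutualInfo [Fintype α] [Fintype β] (q : ℕ) (p : PMF Ω) (X : Ω → α) (Y : Ω → β) : ℝ :=
  entropy q p X - condEntropy q p X Y

/-- Conditional mutual information `I(X ; Y | Z) = H(X | Z) - H(X | Y, Z)`. -/
def condMutualInfo [Fintype α] [Fintype β] [Fintype γ] (q : ℕ) (p : PMF Ω)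
    (X : Ω → α) (Y : Ω → β) (Z : Ω → γ) : ℝ :=
  condEntropy q p X Z - condEntropy q p X (fun ω => (Y ω, Z ω))

end Information

/-! ### The demand matrix -/

/-- Demand matrices: full row rank, and every user has a nonzero coefficient in some row. -/
def Admissible {F : Type u} [Field F] {K Kc : ℕ} (A : Matrix (Fin Kc) (Fin K) F) : Prop :=
  A.rank = Kc ∧ ∀ i, ∃ n, A n i ≠ 0

theorem exists_admissible (F : Type u) [Field F] {K Kc : ℕ} (h0 : 0 < Kc) (h : Kc ≤ K) :
    ∃ A : Matrix (Fin Kc) (Fin K) F, Admissible A := by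
  refine ⟨fun n i => if i.val = n.val ∨ (Kc ≤ i.val ∧ n.val = 0) then 1 else 0, ?_, ?_⟩
  · have hli : LinearIndependent F (Matrix.row (fun (n : Fin Kc) (i : Fin K) =>
        if i.val = n.val ∨ (Kc ≤ i.val ∧ n.val = 0) then (1 : F) else 0)) := by
      rw [Fintype.linearIndependent_iff]
      intro c hc n
      have h1 := congrFun hc (Fin.castLE h n)
      rw [Finset.sum_apply, Finset.sum_eq_single n] at h1
      · simpa [Matrix.row] using h1
      · intro m _ hm
        have h2 : n.val ≠ m.val := fun e => hm (Fin.ext e.symm)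
        have h3 : ¬ Kc ≤ n.val := by omega
        simp [Matrix.row, h2, h3]
      · simp
    simpa using hli.rank_matrix
  · intro i
    by_cases hi : i.val < Kc
    · exact ⟨⟨i.val, hi⟩, by simp⟩
    · exact ⟨⟨0, h0⟩, by simp [not_lt.mp hi]⟩

open Classical in
/-- The law of the demand matrix: i.i.d. uniform entries conditioned on admissibility, that is,
the uniform law on the admissible matrices. -/
def demandLaw (F : Type u) [Field F] [Fintype F] (K Kc : ℕ) (h0 : 0 < Kc) (h : Kc ≤ K) :
    PMF (Matrix (Fin Kc) (Fin K) F) :=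
  PMF.uniformOfFinset (Finset.univ.filter fun A => Admissible A)
    (by
      obtain ⟨A, hA⟩ := exists_admissible F h0 h
      exact ⟨A, by simpa using hA⟩)

/-! ### Two-round schemes -/

/-- A two-round scheme for `K` users with input length `L` over `F` and `Kc` requested linear
combinations.  `U₁` is the set of users that survive the first round.  The objects indexed by
`U₁` and a user `i` are used only for `i ∈ U₁`. -/
structure Scheme (F : Type u) (K Kc L : ℕ) where
  /-- The alphabet of the key `P i` of user `i`. -/
  Key : Fin K → Type u
  [keyFintype : ∀ i, Fintype (Key i)]
  /-- The joint law of the keys. -/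
  keyLaw : PMF (∀ i, Key i)
  /-- The private randomness of the server. -/
  Coins : Type u
  coinsLaw : PMF Coins
  /-- The first-round queries; they depend on the demand and on the server's randomness. -/
  Query₁ : Fin K → Type u
  [query₁Fintype : ∀ i, Fintype (Query₁ i)]
  query₁ : Matrix (Fin Kc) (Fin K) F → Coins → ∀ i, Query₁ i
  /-- The second-round queries; they depend moreover on `U₁`. -/
  Query₂ : Finset (Fin K) → Fin K → Type u
  [query₂Fintype : ∀ U₁ i, Fintype (Query₂ U₁ i)]
  query₂ : ∀ U₁ : Finset (Fin K), Matrix (Fin Kc) (Fin K) F → Coins → ∀ i, Query₂ U₁ i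
  /-- The number of symbols of the first-round message of user `i`. -/
  len₁ : Fin K → ℕ
  /-- The first-round message of user `i`, computed from its input, its key and its query. -/
  msg₁ : ∀ i, (Fin L → F) → Key i → Query₁ i → (Fin (len₁ i) → F)
  /-- The number of symbols of the second-round message of user `i`. -/
  len₂ : Finset (Fin K) → Fin K → ℕ
  /-- The second-round message of user `i`, computed from its input, its key, its two queries
  and `U₁`. -/
  msg₂ : ∀ (U₁ : Finset (Fin K)) (i : Fin K),
    (Fin L → F) → Key i → Query₁ i → Query₂ U₁ i → (Fin (len₂ U₁ i) → F)

attribute [instance] Scheme.keyFintype Scheme.query₁Fintype Scheme.query₂Fintype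

namespace Scheme

variable {F : Type u} [Field F] [Fintype F] {K Kc L : ℕ}

/-- An outcome: all the inputs, all the keys, the demand matrix, the server's randomness. -/
structure Outcome (S : Scheme F K Kc L) where
  W : Fin K → Fin L → F
  P : ∀ i, S.Key i
  A : Matrix (Fin Kc) (Fin K) F
  coins : S.Coins

/-- The joint law: the inputs are i.i.d. uniform, and the inputs, the keys, the demand matrix
(of law `D`) and the server's randomness are independent. -/
def law (S : Scheme F K Kc L) (D : PMF (Matrix (Fin Kc) (Fin K) F)) : PMF S.Outcome :=
  (PMF.uniformOfFintype (Fin K → Fin L → F)).bind fun W =>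
    S.keyLaw.bind fun P =>
      D.bind fun A =>
        S.coinsLaw.bind fun c =>
          PMF.pure ⟨W, P, A, c⟩

section RandomVariables

variable (S : Scheme F K Kc L)

/-- The first-round query to user `i`. -/
def Q₁ (i : Fin K) (ω : S.Outcome) : S.Query₁ i := S.query₁ ω.A ω.coins i

/-- The second-round query to user `i`. -/
def Q₂ (U₁ : Finset (Fin K)) (i : Fin K) (ω : S.Outcome) : S.Query₂ U₁ i :=
  S.query₂ U₁ ω.A ω.coins i

/-- The first-round message of user `i`. -/
def X (i : Fin K) (ω : S.Outcome) : Fin (S.len₁ i) → F :=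
  S.msg₁ i (ω.W i) (ω.P i) (S.Q₁ i ω)

/-- The second-round message of user `i`. -/
def Y (U₁ : Finset (Fin K)) (i : Fin K) (ω : S.Outcome) : Fin (S.len₂ U₁ i) → F :=
  S.msg₂ U₁ i (ω.W i) (ω.P i) (S.Q₁ i ω) (S.Q₂ U₁ i ω)

/-- The requested combinations `∑ i ∈ U₁, a n i • W i`, for `n` in `Fin Kc`. -/
def target (U₁ : Finset (Fin K)) (ω : S.Outcome) : Fin Kc → Fin L → F :=
  fun n => ∑ i ∈ U₁, ω.A n i • ω.W i

end RandomVariables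

/-- Decodability: whatever the surviving sets `U₂ ⊆ U₁` of at least `U` users, the received
messages and the queries determine the requested combinations. -/
def Decodable (S : Scheme F K Kc L) (U : ℕ) (D : PMF (Matrix (Fin Kc) (Fin K) F)) : Prop :=
  ∀ U₁ U₂ : Finset (Fin K), U₂ ⊆ U₁ → U ≤ U₂.card →
    condEntropy (Fintype.card F) (S.law D) (S.target U₁)
      (fun ω => ((fun i : U₁ => S.X i ω), (fun i : Fin K => S.Q₁ i ω),
        (fun i : U₁ => S.Q₂ U₁ i ω), (fun i : U₂ => S.Y U₁ i ω))) = 0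

/-- Security: given the demand matrix, which the server knows, and the requested combinations,
all the messages and queries carry no information about the inputs. -/
def Secure (S : Scheme F K Kc L) (U : ℕ) (D : PMF (Matrix (Fin Kc) (Fin K) F)) : Prop :=
  ∀ U₁ : Finset (Fin K), U ≤ U₁.card →
    condMutualInfo (Fintype.card F) (S.law D) (fun ω => ω.W)
      (fun ω => ((fun i : Fin K => S.X i ω), (fun i : U₁ => S.Y U₁ i ω),
        (fun i : Fin K => S.Q₁ i ω), (fun i : U₁ => S.Q₂ U₁ i ω)))
      (fun ω => (ω.A, S.target U₁ ω)) = 0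

/-- Demand privacy: what a single user sees is independent of the demand matrix.  A user outside
`U₁` takes no part in the second round. -/
def DemandPrivate (S : Scheme F K Kc L) (U : ℕ) (D : PMF (Matrix (Fin Kc) (Fin K) F)) : Prop :=
  ∀ U₁ : Finset (Fin K), U ≤ U₁.card → ∀ i : Fin K,
    (i ∈ U₁ → mutualInfo (Fintype.card F) (S.law D) (fun ω => ω.A)
      (fun ω => (ω.W i, ω.P i, S.Q₁ i ω, S.Q₂ U₁ i ω, S.X i ω, S.Y U₁ i ω)) = 0) ∧
    (i ∉ U₁ → mutualInfo (Fintype.card F) (S.law D) (fun ω => ω.A)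
      (fun ω => (ω.W i, ω.P i, S.Q₁ i ω, S.X i ω)) = 0)

/-- First-round rate: the largest number of symbols sent by a user, per input symbol. -/
def rate₁ (S : Scheme F K Kc L) : ℝ :=
  ((Finset.univ.sup S.len₁ : ℕ) : ℝ) / L

/-- Second-round rate: the largest number of symbols sent by a user of `U₁`, over all the
possible `U₁`, per input symbol. -/
def rate₂ (S : Scheme F K Kc L) (U : ℕ) : ℝ :=
  (((Finset.univ.filter fun U₁ : Finset (Fin K) => U ≤ U₁.card).sup
    fun U₁ => U₁.sup (S.len₂ U₁) : ℕ) : ℝ) / L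

end Scheme

end SecAgg

end

/-!
Put `d = U - 1` and `L = d * m`, and cut every input into `d` elements of the extension field `E` of
degree `m` of `F`, which for large `m` contains `K` distinct points `x i`.  Since users do not
collude with the server, all of them may hold the same key: a one-time pad `Z l` for every user `l`
and a noise `N` in `E ^ Kc`.  The first-round messages `X l = W l + Z l` reduce the problem to
retrieving the combinations `∑ l ∈ U₁, A n l • Z l` from replicated data without revealing `A` to a
single user.

The query to user `i` is the vector `A n l * x i ^ (k + 1)`, for `k < d`, plus a uniform vector `r`
that is common to all users (`scheme`).  The pairing of the query with the pieces of the masks, plus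
`N n`, is the value at `x i` of a polynomial of degree at most `d` whose nonconstant coefficients
are the pieces of the requested combination, and whose constant coefficient collects the
interference of `r` and `N n` (`response_queryShift`).

* Decodability: `d + 1 = U` values determine such a polynomial (`decodable_scheme`).
* Demand privacy: a single query is a one-time pad of the demand (`demandPrivate_scheme`).
* Security: given the demand and the requested combinations of the inputs, the server's view is a
  bijective function of `X`, `r` and the constant coefficients.  For fixed inputs and demand, these
  are obtained from the uniform variables `Z`, `r`, `N` by a bijection (`unmask`), hence they are
  independent of the inputs (`secure_scheme`).

Each second-round message has `Kc` symbols of `E`, that is, `Kc * m = Kc * L / (U - 1)` symbols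
of `F`.
-/

/-! ### Information quantities of independent and of uniform variables -/

noncomputable section

namespace SecAgg

section Information

variable {Ω Ω' α β γ δ : Type*}

theorem entropy_map [Fintype α] (q : ℕ) (p : PMF Ω') (h : Ω' → Ω) (X : Ω → α) :
    entropy q (p.map h) X = entropy q p (fun ω => X (h ω)) := by
  simp only [entropy, PMF.map_comp]
  rfl

/-- Two random variables that are functions of each other have the same entropy. -/
theorem entropy_eq_of_equiv [Fintype α] [Fintype β] (q : ℕ) (p : PMF Ω) {X : Ω → α} {Y : Ω → β}
    (f : α → β) (g : β → α) (hf : ∀ ω, f (X ω) = Y ω) (hg : ∀ ω, g (Y ω) = X ω) :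
    entropy q p X = entropy q p Y := by
  classical
  have hX : ∀ a, p.map X a ≠ 0 → g (f a) = a := by
    intro a ha
    rw [← PMF.mem_support_iff, PMF.mem_support_map_iff] at ha
    obtain ⟨ω, -, rfl⟩ := ha
    rw [hf, hg]
  have hY : (p.map X).map f = p.map Y := by
    rw [PMF.map_comp]
    exact congrArg (fun h => p.map h) (funext hf)
  have hval : ∀ a, p.map X a ≠ 0 → p.map Y (f a) = p.map X a := by
    intro a ha
    rw [← hY, PMF.map_apply, tsum_eq_single a]
    · simp
    · intro b hb
      by_cases hfb : f a = f b
      · rw [if_pos hfb]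
        by_contra h0
        exact hb (by rw [← hX a ha, hfb, hX b h0])
      · rw [if_neg hfb]
  have hne : ∀ a, (p.map X a).toReal * Real.logb q (p.map X a).toReal ≠ 0 → p.map X a ≠ 0 := by
    intro a h h0
    simp [h0] at h
  unfold entropy
  congr 1
  refine Finset.sum_bij_ne_zero (fun a _ _ => f a) (fun _ _ _ => Finset.mem_univ _) ?_ ?_ ?_
  · intro a _ ha b _ hb hab
    rw [← hX a (hne a ha), hab, hX b (hne b hb)]
  · intro b _ hb
    have hb0 : p.map Y b ≠ 0 := by
      intro h0
      simp [h0] at hb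
    have hb1 := hb0
    rw [← PMF.mem_support_iff, PMF.mem_support_map_iff] at hb1
    obtain ⟨ω, hω, rfl⟩ := hb1
    have hXω : p.map X (X ω) ≠ 0 := by
      rw [← PMF.mem_support_iff, PMF.mem_support_map_iff]
      exact ⟨ω, hω, rfl⟩
    refine ⟨X ω, Finset.mem_univ _, ?_, hf ω⟩
    rwa [← hval _ hXω, hf]
  · intro a _ ha
    rw [hval a (hne a ha)]

/-- A random variable that is determined by `Y` has no entropy given `Y`. -/
theorem condEntropy_eq_zero_of_factorsThrough [Fintype α] [Fintype β] (q : ℕ) (p : PMF Ω)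
    {X : Ω → α} {Y : Ω → β} (h : X.FactorsThrough Y) : condEntropy q p X Y = 0 := by
  obtain ⟨ω₀, -⟩ := p.support_nonempty
  rw [condEntropy, sub_eq_zero]
  refine entropy_eq_of_equiv q p Prod.snd (fun b => (Function.extend Y X (fun _ => X ω₀) b, b))
    (fun _ => rfl) (fun ω => ?_)
  rw [h.extend_apply]

theorem condEntropy_map [Fintype α] [Fintype β] (q : ℕ) (p : PMF Ω') (h : Ω' → Ω) (X : Ω → α)
    (Y : Ω → β) :
    condEntropy q (p.map h) X Y = condEntropy q p (fun ω => X (h ω)) (fun ω => Y (h ω)) := by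
  simp only [condEntropy, entropy_map]

/-- The product law of two laws. -/
def prodLaw (p : PMF α) (r : PMF β) : PMF (α × β) :=
  p.bind fun a => r.map fun b => (a, b)

theorem prodLaw_apply (p : PMF α) (r : PMF β) (a : α) (b : β) :
    prodLaw p r (a, b) = p a * r b := by
  classical
  rw [prodLaw, PMF.bind_apply, tsum_eq_single a]
  · rw [PMF.map_apply, tsum_eq_single b]
    · simp
    · intro b' hb'
      simp [hb'.symm]
  · intro a' ha'
    simp [PMF.map_apply, ha'.symm]

theorem prodLaw_bind (p : PMF α) (r : PMF β) (f : α × β → PMF γ) :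
    (prodLaw p r).bind f = p.bind fun a => r.bind fun b => f (a, b) := by
  simp only [prodLaw, PMF.bind_bind, PMF.bind_map]
  rfl

theorem map_prodLaw (p : PMF α) (r : PMF β) (f : α → γ) (g : β → δ) :
    (prodLaw p r).map (fun x => (f x.1, g x.2)) = prodLaw (p.map f) (r.map g) := by
  simp only [prodLaw, PMF.map_bind, PMF.map_comp, PMF.bind_map]
  rfl

theorem map_fst_prodLaw (p : PMF α) (r : PMF β) : (prodLaw p r).map Prod.fst = p := by
  simp only [prodLaw, PMF.map_bind, PMF.map_comp]
  calc _ = p.bind PMF.pure := by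
        congr 1
        funext a
        exact PMF.map_const r a
    _ = p := PMF.bind_pure p

theorem map_snd_prodLaw (p : PMF α) (r : PMF β) : (prodLaw p r).map Prod.snd = r := by
  simp only [prodLaw, PMF.map_bind, PMF.map_comp]
  calc _ = p.bind fun _ => r := by
        congr 1
        funext a
        exact PMF.map_id r
    _ = r := PMF.bind_const p r

theorem prodLaw_uniform [Fintype α] [Nonempty α] [Fintype β] [Nonempty β] :
    prodLaw (PMF.uniformOfFintype α) (PMF.uniformOfFintype β) =
      PMF.uniformOfFintype (α × β) := by
  ext ⟨a, b⟩
  rw [prodLaw_apply]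
  simp only [PMF.uniformOfFintype_apply, Fintype.card_prod, Nat.cast_mul]
  rw [ENNReal.mul_inv] <;> simp

theorem uniform_map_equiv [Fintype α] [Nonempty α] (σ : α ≃ α) :
    (PMF.uniformOfFintype α).map σ = PMF.uniformOfFintype α := by
  classical
  ext a
  rw [PMF.map_apply, tsum_eq_single (σ.symm a)]
  · simp
  · intro b hb
    rw [if_neg]
    rintro rfl
    simp at hb

theorem sum_toReal_eq_one [Fintype α] (p : PMF α) : ∑ a, (p a).toReal = 1 := by
  have h := p.tsum_coe
  rw [tsum_fintype] at h
  rw [← ENNReal.toReal_sum fun a _ => p.apply_ne_top a, h, ENNReal.toReal_one]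

/-- Entropy is additive over independent random variables. -/
theorem entropy_prodLaw [Fintype γ] [Fintype δ] (q : ℕ) (p : PMF α) (r : PMF β) (f : α → γ)
    (g : β → δ) :
    entropy q (prodLaw p r) (fun x => (f x.1, g x.2)) = entropy q p f + entropy q r g := by
  unfold entropy
  rw [map_prodLaw, Fintype.sum_prod_type, ← neg_add]
  congr 1
  have key : ∀ s t : ℝ, s * t * Real.logb q (s * t) =
      t * (s * Real.logb q s) + s * (t * Real.logb q t) := by
    intro s t
    rcases eq_or_ne s 0 with rfl | hs
    · simp
    rcases eq_or_ne t 0 with rfl | ht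
    · simp
    rw [Real.logb_mul hs ht]
    ring
  simp only [prodLaw_apply, ENNReal.toReal_mul, key, Finset.sum_add_distrib, ← Finset.sum_mul,
    ← Finset.mul_sum, sum_toReal_eq_one, one_mul]

theorem entropy_prodLaw_fst [Fintype γ] (q : ℕ) (p : PMF α) (r : PMF β) (f : α → γ) :
    entropy q (prodLaw p r) (fun x => f x.1) = entropy q p f := by
  rw [← entropy_map q (prodLaw p r) Prod.fst f, map_fst_prodLaw]

theorem entropy_prodLaw_snd [Fintype δ] (q : ℕ) (p : PMF α) (r : PMF β) (g : β → δ) :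
    entropy q (prodLaw p r) (fun x => g x.2) = entropy q r g := by
  rw [← entropy_map q (prodLaw p r) Prod.snd g, map_snd_prodLaw]

/-- A bijective substitution of a uniform variable, which may depend on an independent one,
leaves the joint law unchanged. -/
theorem prodLaw_uniform_map_equiv [Fintype β] [Nonempty β] (p : PMF α) (σ : α → β ≃ β) :
    (prodLaw p (PMF.uniformOfFintype β)).map (fun x => (x.1, σ x.1 x.2)) =
      prodLaw p (PMF.uniformOfFintype β) := by
  simp only [prodLaw, PMF.map_bind, PMF.map_comp]
  congr 1
  funext a
  conv_rhs => rw [← uniform_map_equiv (σ a)]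
  rw [PMF.map_comp]
  rfl

/-- The one-time pad: if a bijective substitution of the uniform variable turns `V` into a
function of that variable alone, then `V` carries no information about the other one. -/
theorem mutualInfo_eq_zero_of_substitution [Fintype α] [Fintype γ] [Fintype β] [Nonempty β]
    (q : ℕ) (p : PMF α) (σ : α → β ≃ β) (V : α × β → γ) (v : β → γ)
    (hV : ∀ a b, V (a, σ a b) = v b) :
    mutualInfo q (prodLaw p (PMF.uniformOfFintype β)) (fun x => x.1) V = 0 := by
  have hV' : (fun x : α × β => V (x.1, σ x.1 x.2)) = fun x => v x.2 := funext fun x => hV _ _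
  unfold mutualInfo condEntropy
  rw [← prodLaw_uniform_map_equiv p σ]
  simp only [entropy_map]
  rw [hV']
  simp only [hV]
  rw [entropy_prodLaw_fst q p _ (fun a => a), entropy_prodLaw_snd,
    entropy_prodLaw q p _ (fun a => a) v]
  ring

/-- The conditional one-time pad: after a bijective substitution of the uniform variable `b`,
the view `M` is, given `C`, a bijective image of `b`; so it carries no information about the
other variable beyond `C`. -/
theorem condMutualInfo_eq_zero_of_substitution [Fintype α] [Fintype β] [Nonempty β] [Fintype γ]
    [Fintype δ] {ε : Type*} [Fintype ε] (q : ℕ) (p : PMF α) (σ : α → β ≃ β) (w : α → ε)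
    (c : α → δ) (M : α × β → γ) (enc : δ → β → γ) (dec : δ → γ → β)
    (henc : ∀ a b, enc (c a) b = M (a, σ a b)) (hdec : ∀ a b, dec (c a) (M (a, σ a b)) = b) :
    condMutualInfo q (prodLaw p (PMF.uniformOfFintype β)) (fun x => w x.1) M
      (fun x => c x.1) = 0 := by
  unfold condMutualInfo condEntropy
  rw [← prodLaw_uniform_map_equiv p σ]
  simp only [entropy_map]
  set P := prodLaw p (PMF.uniformOfFintype β) with hP
  have h1 : entropy q P (fun x => (M (x.1, σ x.1 x.2), c x.1)) =
      entropy q P (fun x => (c x.1, x.2)) :=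
    entropy_eq_of_equiv q P (fun y => (y.2, dec y.2 y.1)) (fun y => (enc y.1 y.2, y.1))
      (fun x => by simp only [hdec]) (fun x => by simp only [henc])
  have h2 : entropy q P (fun x => (w x.1, M (x.1, σ x.1 x.2), c x.1)) =
      entropy q P (fun x => ((w x.1, c x.1), x.2)) :=
    entropy_eq_of_equiv q P (fun y => ((y.1, y.2.2), dec y.2.2 y.2.1))
      (fun y => (y.1.1, enc y.1.2 y.2, y.1.2))
      (fun x => by simp only [hdec]) (fun x => by simp only [henc])
  rw [h1, h2, hP, entropy_prodLaw q p _ c (fun b => b),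
    entropy_prodLaw q p _ (fun a => (w a, c a)) (fun b => b),
    entropy_prodLaw_fst q p _ c, entropy_prodLaw_fst q p _ (fun a => (w a, c a))]
  ring

end Information

/-! ### Algebra over the extension field -/

/-- Mathlib's extension of degree `m` of a finite field lives in `Type`; here it is lifted to the
universe of the base field, as the alphabets of a `Scheme` require. -/
theorem exists_field_extension (F : Type u) [Field F] [Finite F] (m : ℕ) (hm : 0 < m) :
    ∃ (E : Type u) (_ : Field E) (_ : Algebra F E), Finite E ∧ Module.finrank F E = m := by
  obtain ⟨p, hp⟩ := CharP.exists F
  have : Fact p.Prime := ⟨CharP.char_is_prime F p⟩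
  have : NeZero m := ⟨hm.ne'⟩
  refine ⟨ULift.{u} (FiniteField.Extension F p m), inferInstance, inferInstance, inferInstance, ?_⟩
  rw [(ULift.moduleEquiv (R := F) (M := FiniteField.Extension F p m)).finrank_eq,
    FiniteField.finrank_extension]

/-- A polynomial of degree at most `d` that vanishes at more than `d` points is zero. -/
theorem coeff_eq_zero_of_eval_eq_zero {E ι : Type*} [Field E] {d : ℕ} (x : ι → E)
    (hx : Function.Injective x) (s : Finset ι) (hs : d < s.card) (c : Fin d → E) (b : E)
    (h : ∀ i ∈ s, ∑ k, x i ^ (k.val + 1) * c k + b = 0) : c = 0 := by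
  classical
  set P : Polynomial E := ∑ k : Fin d, Polynomial.monomial (k.val + 1) (c k) + Polynomial.C b
    with hP
  have hdeg : P.degree < s.card := by
    refine lt_of_le_of_lt (b := (d : WithBot ℕ)) ?_ (by exact_mod_cast hs)
    refine Polynomial.degree_add_le_of_degree_le
      ((Polynomial.degree_sum_le _ _).trans (Finset.sup_le fun k _ => ?_))
      (Polynomial.degree_C_le.trans (by exact_mod_cast Nat.zero_le d))
    exact (Polynomial.degree_monomial_le _ _).trans (by exact_mod_cast k.isLt)
  have hP0 : P = 0 := by
    refine Polynomial.eq_zero_of_degree_lt_of_eval_index_eq_zero s (hx.injOn) hdeg ?_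
    intro i hi
    rw [← h i hi, hP, Polynomial.eval_add, Polynomial.eval_finsetSum, Polynomial.eval_C]
    simp [Polynomial.eval_monomial, mul_comm]
  funext k
  have h1 := congrArg (fun Q => Polynomial.coeff Q (k.val + 1)) hP0
  simpa [hP, Polynomial.coeff_monomial, Polynomial.coeff_C, Fin.val_inj] using h1

/-! ### The scheme -/

section Construction

variable {F E : Type u} [Field F] [Field E] [Algebra F E]
  {K Kc L M d : ℕ}

/-- The part of the second-round query to user `i` that carries the demand: the coefficient of
piece `k` of the mask of user `l` in combination `n`.  The exponent is `k + 1` because the constant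
coefficient of the responses is reserved for the interference of the server's randomness. -/
def queryShift (x : Fin K → E) (A : Matrix (Fin Kc) (Fin K) F) (i : Fin K) :
    Fin Kc → Fin K → Fin d → E :=
  fun n l k => algebraMap F E (A n l) * x i ^ (k.val + 1)

/-- The combinations, over `l ∈ U₁`, of the pieces of the masks `Z l` with coefficients `r`.  The map
`e` cuts a vector of length `L` into `d` elements of `E`. -/
def response (e : (Fin L → F) ≃ₗ[F] (Fin d → E)) (U₁ : Finset (Fin K))
    (r : Fin Kc → Fin K → Fin d → E) (Z : Fin K → Fin L → F) : Fin Kc → E :=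
  fun n => ∑ l ∈ U₁, ∑ k, r n l k * e (Z l) k

/-- The value at `y` of the polynomial without constant term whose other coefficients are the
pieces of `Z n`. -/
def maskPoly (e : (Fin L → F) ≃ₗ[F] (Fin d → E)) (y : E) (Z : Fin Kc → Fin L → F) : Fin Kc → E :=
  fun n => ∑ k, y ^ (k.val + 1) * e (Z n) k

theorem response_add (e : (Fin L → F) ≃ₗ[F] (Fin d → E)) (U₁ : Finset (Fin K))
    (r s : Fin Kc → Fin K → Fin d → E) (Z : Fin K → Fin L → F) :
    response e U₁ (r + s) Z = response e U₁ r Z + response e U₁ s Z := by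
  funext n
  simp [response, add_mul, Finset.sum_add_distrib]

/-- The demand enters the response of user `i` only through the requested combinations of the masks,
as the coefficients of a polynomial that is evaluated at `x i`. -/
theorem response_queryShift (e : (Fin L → F) ≃ₗ[F] (Fin d → E)) (x : Fin K → E)
    (U₁ : Finset (Fin K)) (A : Matrix (Fin Kc) (Fin K) F) (i : Fin K) (Z : Fin K → Fin L → F) :
    response e U₁ (queryShift x A i) Z =
      maskPoly e (x i) (fun n => ∑ l ∈ U₁, A n l • Z l) := by
  funext n
  simp only [response, queryShift, maskPoly, map_sum, map_smul, Finset.sum_apply, Pi.smul_apply,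
    Finset.mul_sum]
  rw [Finset.sum_comm]
  exact Finset.sum_congr rfl fun k _ => Finset.sum_congr rfl fun l _ => by
    rw [Algebra.smul_def]
    ring

variable [Fintype F] [Fintype E]

/-- The scheme.  All the users hold the same key, a uniform mask `Z l` for each user `l` and a
uniform noise in `E ^ Kc`.  User `i` sends `W i + Z i` in the first round, without a query.  Its
second-round query is the encoded demand plus a uniform vector common to all users, and it answers
with the response to this query plus the common noise, spelled out over `F` by `φ`. -/
def scheme (e : (Fin L → F) ≃ₗ[F] (Fin d → E)) (φ : (Fin Kc → E) ≃ (Fin M → F))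
    (x : Fin K → E) : Scheme F K Kc L where
  Key := fun _ => (Fin K → Fin L → F) × (Fin Kc → E)
  keyLaw := (PMF.uniformOfFintype ((Fin K → Fin L → F) × (Fin Kc → E))).map fun P _ => P
  Coins := Fin Kc → Fin K → Fin d → E
  coinsLaw := PMF.uniformOfFintype _
  Query₁ := fun _ => PUnit
  query₁ := fun _ _ _ => PUnit.unit
  Query₂ := fun _ _ => Fin Kc → Fin K → Fin d → E
  query₂ := fun _ A r i => queryShift x A i + r
  len₁ := fun _ => L
  msg₁ := fun i W P _ => W + P.1 i
  len₂ := fun _ _ => M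
  msg₂ := fun U₁ _ _ P _ Q => φ (response e U₁ Q P.1 + P.2)

variable (e : (Fin L → F) ≃ₗ[F] (Fin d → E)) (φ : (Fin Kc → E) ≃ (Fin M → F)) (x : Fin K → E)

/-- The outcome with inputs `a.2`, demand `a.1`, common key `b.1` and server randomness `b.2`. -/
def toOutcome (a : Matrix (Fin Kc) (Fin K) F × (Fin K → Fin L → F))
    (b : ((Fin K → Fin L → F) × (Fin Kc → E)) × (Fin Kc → Fin K → Fin d → E)) :
    (scheme e φ x).Outcome :=
  ⟨a.2, fun _ => b.1, a.1, b.2⟩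

theorem law_scheme (D : PMF (Matrix (Fin Kc) (Fin K) F)) :
    (scheme e φ x).law D =
      (prodLaw (prodLaw D (PMF.uniformOfFintype (Fin K → Fin L → F)))
        (PMF.uniformOfFintype (((Fin K → Fin L → F) × (Fin Kc → E)) ×
          (Fin Kc → Fin K → Fin d → E)))).map fun y => toOutcome e φ x y.1 y.2 := by
  have h : (scheme e φ x).law D =
      (PMF.uniformOfFintype (Fin K → Fin L → F)).bind fun W =>
        (PMF.uniformOfFintype ((Fin K → Fin L → F) × (Fin Kc → E))).bind fun P =>
          D.bind fun A =>
            (PMF.uniformOfFintype (Fin Kc → Fin K → Fin d → E)).bind fun c =>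
              PMF.pure (toOutcome e φ x (A, W) (P, c)) :=
    congrArg (PMF.bind _) (funext fun W => PMF.bind_map _ _ _)
  rw [h, ← prodLaw_uniform (α := (Fin K → Fin L → F) × (Fin Kc → E)), ← PMF.bind_pure_comp,
    prodLaw_bind, prodLaw_bind, PMF.bind_comm D]
  congr 1
  funext W
  rw [PMF.bind_comm]
  congr 1
  funext A
  rw [prodLaw_bind]
  rfl

/-- The same law, grouped so that the demand is separated from everything else. -/
theorem law_scheme_assoc (D : PMF (Matrix (Fin Kc) (Fin K) F)) :
    (scheme e φ x).law D =
      (prodLaw D (PMF.uniformOfFintype ((Fin K → Fin L → F) ×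
        (((Fin K → Fin L → F) × (Fin Kc → E)) × (Fin Kc → Fin K → Fin d → E))))).map
          fun y => toOutcome e φ x (y.1, y.2.1) y.2.2 := by
  rw [law_scheme, ← prodLaw_uniform (α := Fin K → Fin L → F)]
  simp only [← PMF.bind_pure_comp, prodLaw_bind, Function.comp_apply]

/-! ### Decodability, demand privacy and security -/

theorem decodable_scheme (hx : Function.Injective x) {U : ℕ} (hd : 1 ≤ d) (hU : d < U)
    (D : PMF (Matrix (Fin Kc) (Fin K) F)) : (scheme e φ x).Decodable U D := by
  intro U₁ U₂ hsub hcard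
  rw [law_scheme, condEntropy_map]
  apply condEntropy_eq_zero_of_factorsThrough
  rintro ⟨⟨A, W⟩, ⟨Z, N⟩, r⟩ ⟨⟨A', W'⟩, ⟨Z', N'⟩, r'⟩ h
  simp only [Prod.mk.injEq] at h
  obtain ⟨hX, -, hQ, hY⟩ := h
  replace hX : ∀ i ∈ U₁, W i + Z i = W' i + Z' i := fun i hi => congrFun hX ⟨i, hi⟩
  replace hQ : ∀ i ∈ U₁, queryShift x A i + r = queryShift x A' i + r' :=
    fun i hi => congrFun hQ ⟨i, hi⟩
  replace hY : ∀ i ∈ U₂, response e U₁ (queryShift x A i + r) Z + N =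
      response e U₁ (queryShift x A' i + r') Z' + N' :=
    fun i hi => φ.injective (congrFun hY ⟨i, hi⟩)
  obtain ⟨i, hi, j, hj, hij⟩ := Finset.one_lt_card.mp (show 1 < U₂.card by omega)
  -- The queries of two users determine the demand, and then the server's randomness.
  have hA : A = A' := by
    ext n l
    have h1 := congrFun (congrFun (congrFun (hQ i (hsub hi)) n) l) ⟨0, hd⟩
    have h2 := congrFun (congrFun (congrFun (hQ j (hsub hj)) n) l) ⟨0, hd⟩
    simp only [queryShift, Pi.add_apply, zero_add, pow_one] at h1 h2
    have h3 : (algebraMap F E (A n l) - algebraMap F E (A' n l)) * (x i - x j) = 0 := by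
      linear_combination h1 - h2
    rcases mul_eq_zero.mp h3 with h3 | h3
    · exact (algebraMap F E).injective (sub_eq_zero.mp h3)
    · exact absurd (hx (sub_eq_zero.mp h3)) hij
  subst hA
  obtain rfl : r = r' := add_left_cancel (hQ i (hsub hi))
  funext n
  -- The responses of the users of `U₂` are the values of one polynomial of degree at most `d` per
  -- requested combination, whose nonconstant coefficients are the combination of the masks.
  have hZ : (∑ l ∈ U₁, A n l • Z l) = ∑ l ∈ U₁, A n l • Z' l := by
    rw [← sub_eq_zero, ← e.map_eq_zero_iff]
    refine coeff_eq_zero_of_eval_eq_zero x hx U₂ (by omega) _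
      (response e U₁ r Z n + N n - (response e U₁ r Z' n + N' n)) ?_
    intro i hi
    have h1 := congrFun (hY i hi) n
    simp only [response_add, response_queryShift, Pi.add_apply, maskPoly] at h1
    simp only [map_sub, Pi.sub_apply, mul_sub, Finset.sum_sub_distrib]
    linear_combination h1
  have hW : ∑ l ∈ U₁, A n l • (W l + Z l) = ∑ l ∈ U₁, A n l • (W' l + Z' l) :=
    Finset.sum_congr rfl fun l hl => by rw [hX l hl]
  simp only [smul_add, Finset.sum_add_distrib, hZ] at hW
  exact add_right_cancel hW

theorem demandPrivate_scheme (U : ℕ) (D : PMF (Matrix (Fin Kc) (Fin K) F)) :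
    (scheme e φ x).DemandPrivate U D := by
  intro U₁ _ i
  -- Replacing the server's randomness `r` by `r - queryShift x A i` turns the query to user `i`
  -- into `r`.
  have hmap : ∀ {γ : Type u} [Fintype γ] (V : (scheme e φ x).Outcome → γ)
      (v : (Fin K → Fin L → F) ×
        (((Fin K → Fin L → F) × (Fin Kc → E)) × (Fin Kc → Fin K → Fin d → E)) → γ)
      (_ : ∀ A W P r, V (toOutcome e φ x (A, W) (P, r - queryShift x A i)) = v (W, P, r)),
      mutualInfo (Fintype.card F) ((scheme e φ x).law D) (fun ω => ω.A) V = 0 := by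
    intro γ _ V v hv
    rw [law_scheme_assoc, mutualInfo, condEntropy_map, entropy_map]
    exact mutualInfo_eq_zero_of_substitution _ D
      (fun A => (Equiv.refl _).prodCongr
        ((Equiv.refl _).prodCongr (Equiv.subRight (queryShift x A i)))) _ v
      (fun A b => hv A b.1 b.2.1 b.2.2)
  constructor
  · intro _
    refine hmap _ (fun b => (b.1 i, b.2.1, PUnit.unit, b.2.2, b.1 i + b.2.1.1 i,
      φ (response e U₁ b.2.2 b.2.1.1 + b.2.1.2))) ?_
    intro A W P r
    have hQ : queryShift x A i + (r - queryShift x A i) = r := add_sub_cancel _ _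
    simp only [Scheme.X, Scheme.Y, Scheme.Q₁, Scheme.Q₂, toOutcome, scheme, hQ]
  · intro _
    exact hmap _ (fun b => (b.1 i, b.2.1, PUnit.unit, b.1 i + b.2.1.1 i)) fun A W P r => rfl

/-- Bijective change of variables: the masks `Z` and `N` are expressed through the first-round
messages `W + Z` and the constant coefficient of the second-round messages. -/
def unmask (U₁ : Finset (Fin K)) (W : Fin K → Fin L → F) :
    (((Fin K → Fin L → F) × (Fin Kc → E)) × (Fin Kc → Fin K → Fin d → E)) ≃
      (((Fin K → Fin L → F) × (Fin Kc → E)) × (Fin Kc → Fin K → Fin d → E)) where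
  toFun b := ((b.1.1 - W, b.1.2 - response e U₁ b.2 (b.1.1 - W)), b.2)
  invFun b := ((b.1.1 + W, b.1.2 + response e U₁ b.2 b.1.1), b.2)
  left_inv b := by simp
  right_inv b := by simp

theorem secure_scheme {U : ℕ} (hU : 0 < U) (D : PMF (Matrix (Fin Kc) (Fin K) F)) :
    (scheme e φ x).Secure U D := by
  intro U₁ hcard
  obtain ⟨i₀, hi₀⟩ := Finset.card_pos.mp (hU.trans_le hcard)
  rw [law_scheme]
  simp only [condMutualInfo, condEntropy_map]
  -- Up to the noise, the response of user `i` is a function of the demand, the requested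
  -- combinations `c.2` and the first-round messages `X`.
  let mask (c : Matrix (Fin Kc) (Fin K) F × (Fin Kc → Fin L → F)) (X : Fin K → Fin L → F)
    (i : Fin K) : Fin Kc → E := maskPoly e (x i) (fun n => ∑ l ∈ U₁, c.1 n l • X l - c.2 n)
  have hY : ∀ A W (X : Fin K → Fin L → F) (N : Fin Kc → E) r i,
      response e U₁ (queryShift x A i + r) (X - W) + (N - response e U₁ r (X - W)) =
        mask (A, fun n => ∑ l ∈ U₁, A n l • W l) X i + N := by
    intro A W X N r i
    rw [response_add, response_queryShift]
    simp only [Pi.sub_apply, smul_sub, Finset.sum_sub_distrib, mask]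
    abel
  refine condMutualInfo_eq_zero_of_substitution (Fintype.card F)
    (prodLaw D (PMF.uniformOfFintype (Fin K → Fin L → F))) (fun a => unmask e U₁ a.2)
    (fun a => a.2) (fun a => (a.1, fun n => ∑ l ∈ U₁, a.1 n l • a.2 l)) _
    (fun c b => (b.1.1, fun i => φ (mask c b.1.1 i + b.1.2), fun _ => PUnit.unit,
      fun i => queryShift x c.1 i + b.2))
    (fun c y => ((y.1, φ.symm (y.2.1 ⟨i₀, hi₀⟩) - mask c y.1 i₀),
      (show Fin Kc → Fin K → Fin d → E from y.2.2.2 ⟨i₀, hi₀⟩) - queryShift x c.1 i₀)) ?_ ?_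
  · rintro ⟨A, W⟩ ⟨⟨X, N⟩, r⟩
    simp only [Scheme.X, Scheme.Y, Scheme.Q₁, Scheme.Q₂, toOutcome, scheme, unmask, Equiv.coe_fn_mk,
      hY, Pi.sub_apply, add_sub_cancel]
  · rintro ⟨A, W⟩ ⟨⟨X, N⟩, r⟩
    simp only [Scheme.X, Scheme.Y, Scheme.Q₁, Scheme.Q₂, toOutcome, scheme, unmask, Equiv.coe_fn_mk,
      hY, Pi.sub_apply, add_sub_cancel, Equiv.symm_apply_apply, add_sub_cancel_left]

/-! ### Rates -/

theorem rate₁_scheme (hK : 0 < K) (hL : 0 < L) : (scheme e φ x).rate₁ = 1 := by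
  have : Nonempty (Fin K) := ⟨⟨0, hK⟩⟩
  have h : (Finset.univ.sup (scheme e φ x).len₁ : ℕ) = L :=
    Finset.sup_const Finset.univ_nonempty L
  rw [Scheme.rate₁, h, div_self]
  exact_mod_cast hL.ne'

theorem rate₂_scheme {U : ℕ} (hK : 0 < K) (hU : U ≤ K) :
    (scheme e φ x).rate₂ U = (M : ℝ) / L := by
  have : Nonempty (Fin K) := ⟨⟨0, hK⟩⟩
  rw [Scheme.rate₂]
  congr 2
  apply le_antisymm
  · exact Finset.sup_le fun U₁ _ => Finset.sup_le fun i _ => le_rfl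
  · refine le_trans ?_ (Finset.le_sup (b := Finset.univ) (by simpa using hU))
    exact (Finset.sup_const Finset.univ_nonempty M).ge

end Construction

end SecAgg

end

theorem theorem5 {F : Type u} [Field F] [Fintype F] (K U Kc : ℕ)
    (hKc : 2 ≤ Kc) (hU : Kc < U) (hK : U ≤ K - 1) :
    ∃ L₀ : ℕ, ∀ L : ℕ, L₀ ≤ L → U - 1 ∣ L →
      ∃ S : SecAgg.Scheme F K Kc L,
        S.Decodable U (SecAgg.demandLaw F K Kc (by omega) (by omega)) ∧
        S.Secure U (SecAgg.demandLaw F K Kc (by omega) (by omega)) ∧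
        S.DemandPrivate U (SecAgg.demandLaw F K Kc (by omega) (by omega)) ∧
        S.rate₁ = 1 ∧
        S.rate₂ U = (Kc : ℝ) / ((U : ℝ) - 1) := by
  -- `L ≥ (U - 1) * K` makes the extension degree `m` at least `K`, so that the field has at
  -- least `2 ^ m ≥ K` elements.
  refine ⟨(U - 1) * K, fun L hL hdvd => ?_⟩
  obtain ⟨m, rfl⟩ := hdvd
  have hd : 0 < U - 1 := by omega
  have hKm : K ≤ m := Nat.le_of_mul_le_mul_left hL hd
  have hm : 0 < m := by omega
  obtain ⟨E, _, _, hE, hrank⟩ := SecAgg.exists_field_extension F m hm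
  have := Fintype.ofFinite E
  have hcardE : Fintype.card E = Fintype.card F ^ m := by
    rw [Module.card_eq_pow_finrank (K := F), hrank]
  have hcard : Fintype.card (Fin K) ≤ Fintype.card E := by
    rw [Fintype.card_fin, hcardE]
    exact hKm.trans (Nat.lt_pow_self Fintype.one_lt_card).le
  obtain ⟨x⟩ := Function.Embedding.nonempty_of_card_le hcard
  have e : (Fin ((U - 1) * m) → F) ≃ₗ[F] (Fin (U - 1) → E) :=
    LinearEquiv.ofFinrankEq _ _ (by simp [Module.finrank_pi_fintype, hrank])
  have φ : (Fin Kc → E) ≃ (Fin (Kc * m) → F) :=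
    Fintype.equivOfCardEq (by simp [hcardE, ← pow_mul, mul_comm])
  refine ⟨SecAgg.scheme e φ x,
    SecAgg.decodable_scheme e φ x x.injective hd (by omega) _,
    SecAgg.secure_scheme e φ x (by omega) _, SecAgg.demandPrivate_scheme e φ x U _,
    SecAgg.rate₁_scheme e φ x (by omega) (Nat.mul_pos hd hm), ?_⟩
  rw [SecAgg.rate₂_scheme e φ x (by omega) (by omega)]
  have hm' : (m : ℝ) ≠ 0 := by exact_mod_cast hm.ne'
  push_cast [Nat.cast_sub (show 1 ≤ U by omega)]
  rw [mul_div_mul_right _ _ hm']
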